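/- **Setting.** There are $N$ items with attraction parameters $0<v_i\le 1$ (and $v_0=1$ for the no-purchase option) and known revenues $r_i\in[0,1]$. For $S\subseteq[N]$ and $w\in[0,\infty)^N$ put $R(S,w)=\frac{\sum_{i\in S}r_iw_i}{1+\sum_{j\in S}w_j}$, and $R(S)=R(S,v)$. A customer who is offered $S$ buys $i\in S$ with probability $\frac{v_i}{1+\sum_{j\in S}v_j}$ and nothing with probability $\frac{1}{1+\sum_{j\in S}v_j}$, independently of the past given $S$. Let $\mathcal S$ be a non-empty family of subsets of $[N]$ that is closed under taking subsets, and let $\alpha\in[0,\tfrac12]$ and $T\ge 1$. **Algorithm 1.** The time steps $t=1,\dots,T-1$ are divided into epochs. At the start of epoch $\ell\ge1$ the seller computes $S_\ell^*\in\arg\max_{S\in\mathcal S}R(S,v^{\mathrm{UCB}}_{\cdot,\ell-1})$ (ties broken by any rule depending on the past), and sets $S_\ell=[N]\setminus S^*_\ell$ with probability $\alpha_\ell=\frac{1}{2\ell^{\alpha}}$ and $S_\ell=S_\ell^*$ with probability $1-\alpha_\ell$. Then $S_\ell$ is offered at every time step until a customer buys nothing, which ends the epoch. Let $\hat v_{i,\ell}$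 be the number of purchases of $i$ in epoch $\ell$, $T_i(\ell)$ the number of epochs $\tau\le\ell$ with $i\in S_\tau$, and $\bar v_{i,\ell}$ the mean of $\hat v_{i,\tau}$ over these epochs. Set $$v^{\mathrm{UCB}}_{i,\ell}=\bar v_{i,\ell}+\sqrt{\bar v_{i,\ell}\tfrac{48\log(\sqrt N\ell+1)}{T_i(\ell)}}+\tfrac{48\log(\sqrt N\ell+1)}{T_i(\ell)}$$ if $T_i(\ell)\ge1$, and $v^{\mathrm{UCB}}_{i,\ell}=1$ if $T_i(\ell)=0$ (in particular for $\ell=0$). Let $L$ be the number of epochs completed within the $T-1$ time steps, and $$\hat v_i=\frac1L\sum_{\ell=1}^{L}\frac{\hat v_{i,\ell}\,\mathbf 1(i\in S_\ell)}{P(i\in S_\ell\mid S_\ell^*)},$$ where $P(i\in S_\ell\mid S^*_\ell)$ is $1-\alpha_\ell$ if $i\in S_\ell^*$ and $\alpha_\ell$ otherwise (and $\hat v_i=0$ if $L=0$). Put $\hat R(S)=R(S,\hat v)$. **Corollary 4.5 (estimation error of $\Delta_R$).** For assortments $S,S'\subseteq[N]$ let $\Delta_R^{S,S'}=R(S)-R(S')$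 and $\hat\Delta_R^{S,S'}=\hat R(S)-\hat R(S')$. Then: 1. for every $\delta\in(0,1)$, with probability at least $1-\delta$, simultaneously for all $S,S'\subseteq[N]$ (in particular for all $S,S'\in\mathcal S$), $$|\hat\Delta_R^{S,S'}-\Delta_R^{S,S'}|\le 72\,\ln\!\left(\tfrac2\delta\right)N^2\left(\tfrac NT\right)^{(1-\alpha)/2};$$ 2. there is a constant $C=C(N)$, depending on $N$ only, such that for all $v$, $r$, $\mathcal S$, $\alpha$, $T$ and tie-breaking rules as above and all $S,S'\subseteq[N]$, $$\mathbb E\,|\hat\Delta_R^{S,S'}-\Delta_R^{S,S'}|\le C\sqrt{T^{\alpha-1}}.$$ -/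

import Mathlib

/-! The multinomial logit (MNL) bandit and the UCB policy with forced exploration of complements. -/

namespace MNLBandit

/-- `(∑_{i ∈ S} r_i w_i) / (1 + ∑_{j ∈ S} w_j)`: the expected revenue of the assortment `S` under
revenues `r` and attraction parameters `w` (with `w_0 = 1` for the no-purchase option).
At `w = v` this is `R(S)`, at the upper confidence bounds it is the optimistic revenue,
at the estimates `v̂` it is the plug-in estimator `R̂(S)`. -/
noncomputable def revenue {N : ℕ} (r w : Fin N → ℝ) (S : Finset (Fin N)) : ℝ :=
  (∑ i ∈ S, r i * w i) / (1 + ∑ j ∈ S, w j)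

/-- MNL choice probabilities when `S` is offered; `none` is the no-purchase option. -/
noncomputable def choiceProb {N : ℕ} (v : Fin N → ℝ) (S : Finset (Fin N)) : Option (Fin N) → ℝ
  | none => 1 / (1 + ∑ j ∈ S, v j)
  | some i => if i ∈ S then v i / (1 + ∑ j ∈ S, v j) else 0

theorem sum_choiceProb {N : ℕ} (v : Fin N → ℝ) (hv : ∀ i, 0 < v i) (S : Finset (Fin N)) :
    ∑ c, ENNReal.ofReal (choiceProb v S c) = 1 := by
  have hs : 0 ≤ ∑ j ∈ S, v j := Finset.sum_nonneg fun j _ => (hv j).le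
  rw [← ENNReal.ofReal_sum_of_nonneg, ENNReal.ofReal_eq_one, Fintype.sum_option]
  · simp only [choiceProb, Finset.sum_ite_mem, Finset.univ_inter, ← Finset.sum_div]
    rw [← add_div, div_self (by positivity)]
  · rintro (_ | i) _
    · simp only [choiceProb]; positivity
    · simp only [choiceProb]
      have := (hv i).le
      split_ifs <;> positivity

/-- The law of the customer's choice when `S` is offered. -/
noncomputable def choice {N : ℕ} (v : Fin N → ℝ) (hv : ∀ i, 0 < v i) (S : Finset (Fin N)) :
    PMF (Option (Fin N)) :=
  PMF.ofFintype (fun c => ENNReal.ofReal (choiceProb v S c)) (sum_choiceProb v hv S)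

/-- The record of one epoch: the optimistic assortment `S*_ℓ`, the assortment `S_ℓ` that is
offered throughout the epoch, and the items bought in the epoch (latest first). -/
structure Epoch (N : ℕ) where
  optimistic : Finset (Fin N)
  offered : Finset (Fin N)
  purchases : List (Fin N)

/-- `v̂_{i,ℓ}`: the number of customers who bought item `i` in the epoch. -/
def Epoch.count {N : ℕ} (e : Epoch N) (i : Fin N) : ℕ := e.purchases.count i

/-- The completed epochs, latest first; its length is the number `ℓ` of completed epochs. -/
abbrev History (N : ℕ) := List (Epoch N)

/-- `T_i(ℓ)`: the number of completed epochs in which item `i` was offered. -/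
def numOffered {N : ℕ} (h : History N) (i : Fin N) : ℕ :=
  (h.filter fun e => i ∈ e.offered).length

/-- `v̄_{i,ℓ}`: the sample mean of `v̂_{i,τ}` over the completed epochs `τ` that offered `i`. -/
noncomputable def sampleMean {N : ℕ} (h : History N) (i : Fin N) : ℝ :=
  ((h.filter fun e => i ∈ e.offered).map fun e => (e.count i : ℝ)).sum / numOffered h i

/-- `v^UCB_{i,ℓ}`; it keeps its initial value `1` as long as item `i` has not been offered. -/
noncomputable def ucb {N : ℕ} (h : History N) (i : Fin N) : ℝ :=
  if numOffered h i = 0 then 1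
  else
    sampleMean h i
      + √(sampleMean h i * (48 * Real.log (√(N : ℝ) * h.length + 1) / numOffered h i))
      + 48 * Real.log (√(N : ℝ) * h.length + 1) / numOffered h i

/-- `sel` picks, after every history, a maximizer over `𝒮` of the optimistic revenue
(ties are broken by an arbitrary rule that may depend on the whole history). -/
def IsOptimisticSelection {N : ℕ} (r : Fin N → ℝ) (𝒮 : Finset (Finset (Fin N)))
    (sel : History N → Finset (Fin N)) : Prop :=
  ∀ h, sel h ∈ 𝒮 ∧ ∀ S ∈ 𝒮, revenue r (ucb h) S ≤ revenue r (ucb h) (sel h)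

/-- `α_ℓ = 1 / (2 ℓ^α)`, the probability of offering the complement in epoch `ℓ ≥ 1`. -/
noncomputable def exploreProb (α : ℝ) (ℓ : ℕ) : ℝ := 1 / (2 * (ℓ : ℝ) ^ α)

theorem exploreProb_mem {α : ℝ} (hα : 0 ≤ α) (n : ℕ) :
    exploreProb α (n + 1) ∈ Set.Icc (0 : ℝ) 1 := by
  have h1 : (1 : ℝ) ≤ ((n + 1 : ℕ) : ℝ) ^ α :=
    Real.one_le_rpow (by exact_mod_cast Nat.le_add_left 1 n) hα
  constructor
  · unfold exploreProb; positivity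
  · unfold exploreProb
    rw [div_le_one (by positivity)]
    linarith

/-- The conditional probability `P(i ∈ S_ℓ | S*_ℓ)`. -/
noncomputable def inclusionProb {N : ℕ} (α : ℝ) (ℓ : ℕ) (Sopt : Finset (Fin N)) (i : Fin N) : ℝ :=
  if i ∈ Sopt then 1 - exploreProb α ℓ else exploreProb α ℓ

/-- The inverse-probability-weighted cumulative estimator `SumV_ℓ(i)`. -/
noncomputable def sumV {N : ℕ} (α : ℝ) : History N → Fin N → ℝ
  | [], _ => 0
  | e :: h, i => sumV α h i +
      if i ∈ e.offered then (e.count i : ℝ) / inclusionProb α (h.length + 1) e.optimistic i else 0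

/-- `v̂_i = SumV_L(i) / L`, where `L` is the number of completed epochs (`0` if `L = 0`). -/
noncomputable def estimate {N : ℕ} (α : ℝ) (h : History N) (i : Fin N) : ℝ :=
  sumV α h i / h.length

/-- The completed epochs together with the running one. -/
structure State (N : ℕ) where
  past : History N
  current : Epoch N

instance (N : ℕ) : MeasurableSpace (State N) := ⊤

/-- A coin that shows `true` with probability `p`. -/
noncomputable def coin (p : ℝ) (hp : p ∈ Set.Icc (0 : ℝ) 1) : PMF Bool :=
  PMF.ofFintype (fun b => ENNReal.ofReal (if b then p else 1 - p)) (by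
    have h0 : 0 ≤ 1 - p := sub_nonneg.mpr hp.2
    simp [← ENNReal.ofReal_add hp.1 h0])

/-- Start of a new epoch after the history `h`: `S*_ℓ = sel h`, and `S_ℓ` is the complement of
`S*_ℓ` with probability `α_ℓ` and `S*_ℓ` otherwise, where `ℓ = h.length + 1`. -/
noncomputable def newEpoch {N : ℕ} (α : ℝ) (hα : 0 ≤ α) (sel : History N → Finset (Fin N))
    (h : History N) : PMF (State N) :=
  (coin (exploreProb α (h.length + 1)) (exploreProb_mem hα h.length)).map fun b =>
    { past := h
      current :=
        { optimistic := sel h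
          offered := if b then (sel h)ᶜ else sel h
          purchases := [] } }

/-- One time step: the running assortment is offered, a purchase is recorded, and a no-purchase
ends the epoch. -/
noncomputable def step {N : ℕ} (v : Fin N → ℝ) (hv : ∀ i, 0 < v i) (α : ℝ) (hα : 0 ≤ α)
    (sel : History N → Finset (Fin N)) (s : State N) : PMF (State N) :=
  (choice v hv s.current.offered).bind fun c =>
    match c with
    | none => newEpoch α hα sel (s.current :: s.past)
    | some i => PMF.pure
        { past := s.past
          current := { s.current with purchases := i :: s.current.purchases } }

/-- The law of the state after `n` time steps. -/
noncomputable def run {N : ℕ} (v : Fin N → ℝ) (hv : ∀ i, 0 < v i) (α : ℝ) (hα : 0 ≤ α)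
    (sel : History N → Finset (Fin N)) : ℕ → PMF (State N)
  | 0 => newEpoch α hα sel []
  | n + 1 => (run v hv α hα sel n).bind (step v hv α hα sel)

/-- The law of the final state of the policy with horizon `T`. The loop `while t < T`, started at
`t = 1`, makes `T - 1` steps, so that the number of completed epochs in the final state is
`L = min {L | |E_1| + ... + |E_{L+1}| ≥ T}`. -/
noncomputable def law {N : ℕ} (v : Fin N → ℝ) (hv : ∀ i, 0 < v i) (α : ℝ) (hα : 0 ≤ α)
    (sel : History N → Finset (Fin N)) (T : ℕ) : MeasureTheory.Measure (State N) :=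
  (run v hv α hα sel (T - 1)).toMeasure

/-- `|Δ̂_R - Δ_R|` for the revenue difference of the assortments `S` and `S'`, as a function of the
final state. -/
noncomputable def diffError {N : ℕ} (v r : Fin N → ℝ) (α : ℝ) (S S' : Finset (Fin N))
    (s : State N) : ℝ :=
  |(revenue r (estimate α s.past) S - revenue r (estimate α s.past) S')
    - (revenue r v S - revenue r v S')|

end MNLBandit

/-! If an epoch offers item `i`, its number of purchases of `i` is geometric with mean `v i`,
whatever else is offered. The inverse-probability weight makes the expected contribution of every
epoch to `sumV` equal to `v i`, given the past. So the centered sum is a martingale over epochs, and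
Chernoff's method applies: with `|lam| * (2 * T ^ α) ≤ 1 / 4` and drift `d = 8 * lam ^ 2 * T ^ α`,
where `2 * T ^ α` bounds the weights, `expDeviation` is a supermartingale.

The horizon cuts the last epoch short, so the number `L` of completed epochs is not a stopping time
on the epoch scale. The argument therefore runs over time steps: `potential` multiplies the
deviation of the completed epochs by the conditional expectation of the running epoch's factor, and
freezes once the level `M` is reached. `pexp_step_potential_le` shows that it does not increase in
expectation, and Markov's inequality controls all completed epochs at once, in particular the last
one (`law_exceeds_le`).

Used for `lam` and `-lam`, this bounds the error of an estimate by `log M / (lam * L) + d / lam`.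
Each step ends an epoch with probability at least `1 / (N + 1)`, so `L > T / (4 * N)` with high
probability (`law_length_le`), and `lam` is chosen to balance the two terms. The revenue is
1-Lipschitz in the `ℓ¹` norm of the parameters (`abs_revenue_sub_le`), which transfers the bound to
all pairs of assortments simultaneously. Integrating the tail over `δ` gives the expected error. -/

open scoped ENNReal

namespace MNLBandit

/-! ### Expectations under probability mass functions -/

/-- The expectation of a nonnegative function under a probability mass function. -/
noncomputable def pexp {β : Type*} (p : PMF β) (f : β → ℝ≥0∞) : ℝ≥0∞ := ∑' a, p a * f a

theorem pexp_bind {β γ : Type*} (p : PMF β) (k : β → PMF γ) (f : γ → ℝ≥0∞) :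
    pexp (p.bind k) f = pexp p fun a => pexp (k a) f := by
  simp only [pexp, PMF.bind_apply, ← ENNReal.tsum_mul_right, ← ENNReal.tsum_mul_left]
  rw [ENNReal.tsum_comm]
  simp only [mul_assoc]

theorem pexp_pure {β : Type*} (a : β) (f : β → ℝ≥0∞) : pexp (PMF.pure a) f = f a := by
  classical
  simp only [pexp, PMF.pure_apply]
  rw [tsum_eq_single a (by intro b hb; simp [hb])]
  simp

theorem pexp_map {β γ : Type*} (p : PMF β) (k : β → γ) (f : γ → ℝ≥0∞) :
    pexp (p.map k) f = pexp p (f ∘ k) := by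
  simp only [PMF.map, pexp_bind, Function.comp_apply, pexp_pure]
  rfl

theorem pexp_mono {β : Type*} (p : PMF β) {f g : β → ℝ≥0∞} (h : ∀ a, f a ≤ g a) :
    pexp p f ≤ pexp p g :=
  ENNReal.tsum_le_tsum fun a => mul_le_mul_right (h a) _

theorem pexp_const {β : Type*} (p : PMF β) (c : ℝ≥0∞) : pexp p (fun _ => c) = c := by
  simp [pexp, ENNReal.tsum_mul_right, p.tsum_coe]

theorem pexp_const_mul {β : Type*} (p : PMF β) (c : ℝ≥0∞) (f : β → ℝ≥0∞) :
    pexp p (fun a => c * f a) = c * pexp p f := by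
  simp only [pexp, ← ENNReal.tsum_mul_left]
  exact tsum_congr fun a => mul_left_comm _ _ _

/-- Markov's inequality. -/
theorem mul_toMeasure_le_pexp {β : Type*} [MeasurableSpace β] (p : PMF β) (f : β → ℝ≥0∞)
    {A : Set β} (hA : MeasurableSet A) (c : ℝ≥0∞) (h : ∀ a ∈ A, c ≤ f a) :
    c * p.toMeasure A ≤ pexp p f := by
  rw [PMF.toMeasure_apply p hA, ← ENNReal.tsum_mul_left]
  refine ENNReal.tsum_le_tsum fun a => ?_
  by_cases ha : a ∈ A
  · rw [Set.indicator_of_mem ha, mul_comm]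
    exact mul_le_mul_right (h a ha) _
  · simp [ha]

theorem pexp_coin (p : ℝ) (hp : p ∈ Set.Icc (0 : ℝ) 1) (f : Bool → ℝ≥0∞) :
    pexp (coin p hp) f = ENNReal.ofReal p * f true + ENNReal.ofReal (1 - p) * f false := by
  simp [pexp, coin, PMF.ofFintype_apply]

theorem pexp_choice {N : ℕ} (v : Fin N → ℝ) (hv : ∀ i, 0 < v i) (S : Finset (Fin N))
    (f : Option (Fin N) → ℝ≥0∞) :
    pexp (choice v hv S) f = ∑ c, ENNReal.ofReal (choiceProb v S c) * f c := by
  simp [pexp, choice, PMF.ofFintype_apply, tsum_fintype]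

theorem choiceProb_nonneg {N : ℕ} (v : Fin N → ℝ) (hv : ∀ i, 0 < v i) (S : Finset (Fin N))
    (c : Option (Fin N)) : 0 ≤ choiceProb v S c := by
  have hs : 0 ≤ ∑ j ∈ S, v j := Finset.sum_nonneg fun j _ => (hv j).le
  rcases c with _ | i
  · simp only [choiceProb]; positivity
  · simp only [choiceProb]
    have := (hv i).le
    split_ifs <;> positivity

theorem pexp_choice_ofReal {N : ℕ} (v : Fin N → ℝ) (hv : ∀ i, 0 < v i) (S : Finset (Fin N))
    (f : Option (Fin N) → ℝ) (hf : ∀ c, 0 ≤ f c) :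
    pexp (choice v hv S) (fun c => ENNReal.ofReal (f c)) =
      ENNReal.ofReal ((f none + ∑ i ∈ S, v i * f (some i)) / (1 + ∑ j ∈ S, v j)) := by
  rw [pexp_choice]
  simp only [← ENNReal.ofReal_mul (choiceProb_nonneg v hv S _)]
  rw [← ENNReal.ofReal_sum_of_nonneg
    (fun c _ => mul_nonneg (choiceProb_nonneg v hv S c) (hf c)), Fintype.sum_option]
  congr 1
  simp only [choiceProb, ite_mul, zero_mul, Finset.sum_ite_mem, Finset.univ_inter]
  rw [add_div, Finset.sum_div]
  congr 1
  · ring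
  · exact Finset.sum_congr rfl fun i _ => by ring

/-! ### Expectations along a run of the policy -/

section Policy

variable {N : ℕ} (v : Fin N → ℝ) (hv : ∀ i, 0 < v i) (α : ℝ) (hα : 0 ≤ α)
  (sel : History N → Finset (Fin N))

theorem pexp_step (s : State N) (f : State N → ℝ≥0∞) :
    pexp (step v hv α hα sel s) f = pexp (choice v hv s.current.offered) fun c =>
      match c with
      | none => pexp (newEpoch α hα sel (s.current :: s.past)) f
      | some i => f ⟨s.past, { s.current with purchases := i :: s.current.purchases }⟩ := by
  rw [step, pexp_bind]
  congr 1
  funext c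
  rcases c with _ | i
  · rfl
  · simp only [pexp_pure]

/-- Iterates a one-step drift bound. It serves with `K < 1` to count epochs and with `K = 1` for the
supermartingale. -/
theorem pexp_run_le {f : State N → ℝ≥0∞} {K B : ℝ≥0∞}
    (h0 : pexp (newEpoch α hα sel []) f ≤ B)
    (hstep : ∀ s, pexp (step v hv α hα sel s) f ≤ K * f s) (n : ℕ) :
    pexp (run v hv α hα sel n) f ≤ K ^ n * B := by
  induction n with
  | zero => simpa [run] using h0
  | succ n ih =>
    rw [run, pexp_bind]
    refine (pexp_mono _ hstep).trans ?_
    rw [pexp_const_mul, pow_succ', mul_assoc]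
    exact mul_le_mul_right ih _

theorem past_eq_of_mem_support_newEpoch {h : History N} {s : State N}
    (hs : s ∈ (newEpoch α hα sel h).support) : s.past = h := by
  rw [newEpoch, PMF.mem_support_map_iff] at hs
  obtain ⟨b, -, rfl⟩ := hs
  rfl

/-- A step ends at most one epoch. Hence `T - 1` steps never complete `T` epochs, and killing
`potential` at `T` epochs loses no mass. -/
theorem length_le_of_mem_support_run {n : ℕ} {s : State N}
    (hs : s ∈ (run v hv α hα sel n).support) : s.past.length ≤ n := by
  induction n generalizing s with
  | zero => simp [past_eq_of_mem_support_newEpoch α hα sel hs]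
  | succ n ih =>
    rw [run, PMF.mem_support_bind_iff] at hs
    obtain ⟨s', hs', hs⟩ := hs
    rw [step, PMF.mem_support_bind_iff] at hs
    obtain ⟨c, -, hs⟩ := hs
    have := ih hs'
    rcases c with _ | i
    · rw [past_eq_of_mem_support_newEpoch α hα sel hs, List.length_cons]
      omega
    · simp only [PMF.mem_support_pure_iff] at hs
      subst hs
      exact this.trans n.le_succ

end Policy

theorem pexp_newEpoch {N : ℕ} (α : ℝ) (hα : 0 ≤ α) (sel : History N → Finset (Fin N))
    (h : History N) (f : State N → ℝ≥0∞) :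
    pexp (newEpoch α hα sel h) f =
      ENNReal.ofReal (exploreProb α (h.length + 1)) * f ⟨h, sel h, (sel h)ᶜ, []⟩ +
        ENNReal.ofReal (1 - exploreProb α (h.length + 1)) * f ⟨h, sel h, sel h, []⟩ := by
  simp [newEpoch, pexp_map, pexp_coin]

theorem pexp_newEpoch_past {N : ℕ} (α : ℝ) (hα : 0 ≤ α) (sel : History N → Finset (Fin N))
    (h : History N) (g : History N → ℝ≥0∞) :
    pexp (newEpoch α hα sel h) (fun s => g s.past) = g h := by
  rw [newEpoch, pexp_map]
  exact pexp_const (coin _ _) (g h)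

/-! ### The number of completed epochs -/

/-- The number of completed epochs has small probability of being at most `m`. -/
theorem law_length_le {N : ℕ} (v : Fin N → ℝ) (hv : ∀ i, 0 < v i) (hv1 : ∀ i, v i ≤ 1) (α : ℝ)
    (hα : 0 ≤ α) (sel : History N → Finset (Fin N)) (T : ℕ) (m : ℝ) :
    law v hv α hα sel T {s | (s.past.length : ℝ) ≤ m} ≤
      ENNReal.ofReal
        (Real.exp m * (1 - (1 - Real.exp (-1)) / (N + 1)) ^ (T - 1)) := by
  have he : Real.exp (-1) < 1 := by simp
  have hK : 0 ≤ 1 - (1 - Real.exp (-1)) / ((N : ℝ) + 1) := by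
    rw [sub_nonneg, div_le_one (by positivity)]
    have := Real.exp_pos (-1)
    have : (0 : ℝ) ≤ N := by positivity
    linarith
  -- The expectation of `exp (-L)` shrinks by this factor at every step: a no-purchase multiplies it
  -- by `exp (-1)` and has probability at least `1 / (N + 1)`, because `v j ≤ 1`.
  have key := pexp_run_le v hv α hα sel
    (f := fun s => ENNReal.ofReal (Real.exp (-(s.past.length : ℝ))))
    (K := ENNReal.ofReal (1 - (1 - Real.exp (-1)) / (N + 1))) (B := 1)
    (by
      rw [pexp_newEpoch_past α hα sel [] (fun h => ENNReal.ofReal (Real.exp (-(h.length : ℝ))))]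
      simp)
    (by
      intro s
      rw [pexp_step]
      have : (fun c : Option (Fin N) => match c with
          | none => pexp (newEpoch α hα sel (s.current :: s.past))
              (fun s => ENNReal.ofReal (Real.exp (-(s.past.length : ℝ))))
          | some i => ENNReal.ofReal (Real.exp (-(s.past.length : ℝ)))) =
          fun c => ENNReal.ofReal (if c = none then Real.exp (-(s.past.length : ℝ) - 1) else
            Real.exp (-(s.past.length : ℝ))) := by
        funext c
        rcases c with _ | i
        · simp only
          rw [pexp_newEpoch_past α hα sel _
            (fun h => ENNReal.ofReal (Real.exp (-(h.length : ℝ))))]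
          simp only [List.length_cons, if_true]
          congr 2
          push_cast
          ring
        · simp
      refine (congrArg (pexp _) this).trans_le ?_
      rw [pexp_choice_ofReal v hv _ _ (fun c => by split_ifs <;> positivity),
        ← ENNReal.ofReal_mul hK]
      apply ENNReal.ofReal_le_ofReal
      have hs : 0 ≤ ∑ j ∈ s.current.offered, v j := Finset.sum_nonneg fun j _ => (hv j).le
      have hsN : ∑ j ∈ s.current.offered, v j ≤ N := by
        calc ∑ j ∈ s.current.offered, v j ≤ ∑ j ∈ s.current.offered, (1 : ℝ) :=
              Finset.sum_le_sum fun j _ => hv1 j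
          _ ≤ N := by
            simp only [Finset.sum_const, nsmul_eq_mul, mul_one]
            exact_mod_cast (Finset.card_le_univ _).trans (Fintype.card_fin N).le
      simp only [if_true, reduceCtorEq, if_false, ← Finset.sum_mul]
      set V := ∑ j ∈ s.current.offered, v j
      have hN : (0 : ℝ) < (N : ℝ) + 1 := by positivity
      rw [sub_eq_add_neg (-(s.past.length : ℝ)) 1, Real.exp_add]
      set x := Real.exp (-(s.past.length : ℝ))
      have hx : 0 < x := Real.exp_pos _
      have : (x * Real.exp (-1) + V * x) / (1 + V) = (1 - (1 - Real.exp (-1)) / (1 + V)) * x := by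
        field_simp
        ring
      rw [this]
      refine mul_le_mul_of_nonneg_right ?_ hx.le
      have := div_le_div_of_nonneg_left (sub_nonneg.2 he.le) (by positivity : 0 < 1 + V)
        (by linarith : 1 + V ≤ (N : ℝ) + 1)
      linarith) (T - 1)
  have hmk := mul_toMeasure_le_pexp (run v hv α hα sel (T - 1))
    (fun s => ENNReal.ofReal (Real.exp (-(s.past.length : ℝ))))
    (A := {s | (s.past.length : ℝ) ≤ m}) (by trivial) (ENNReal.ofReal (Real.exp (-m)))
    (fun s hs => ENNReal.ofReal_le_ofReal (Real.exp_le_exp.2 (neg_le_neg hs)))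
  rw [mul_one, ← ENNReal.ofReal_pow hK] at key
  have h2 := mul_le_mul_right (hmk.trans key) (ENNReal.ofReal (Real.exp m))
  rw [← mul_assoc, ← ENNReal.ofReal_mul (Real.exp_pos _).le, ← Real.exp_add, add_neg_cancel,
    Real.exp_zero, ENNReal.ofReal_one, one_mul, ← ENNReal.ofReal_mul (Real.exp_pos _).le] at h2
  exact h2

/-! ### Moment generating functions -/

/-- The moment generating function at `s` of the geometric law with mean `w`. -/
noncomputable def geomMGF (w s : ℝ) : ℝ := 1 / (1 + w - w * Real.exp s)

theorem geomMGF_denom_ge {w s : ℝ} (hw : 0 < w) (hs : |s| ≤ 1 / 4) :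
    1 - w * (s + s ^ 2) ≤ 1 + w - w * Real.exp s := by
  have h := (abs_le.1 (Real.abs_exp_sub_one_sub_id_le (hs.trans (by norm_num)))).2
  nlinarith

theorem geomMGF_denom_pos {w s : ℝ} (hw : 0 < w) (hw1 : w ≤ 1) (hs : |s| ≤ 1 / 4) :
    0 < 1 + w - w * Real.exp s := by
  have h := geomMGF_denom_ge hw hs
  have := abs_le.1 hs
  nlinarith

theorem geomMGF_le {w s : ℝ} (hw : 0 < w) (hw1 : w ≤ 1) (hs : |s| ≤ 1 / 4) :
    geomMGF w s ≤ 1 + w * s + 4 * w * s ^ 2 := by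
  have h := geomMGF_denom_ge hw hs
  obtain ⟨h1, h2⟩ := abs_le.1 hs
  have hpos : 0 ≤ 1 + w * s + 4 * w * s ^ 2 := by nlinarith [mul_nonneg hw.le (sq_nonneg s)]
  rw [geomMGF, div_le_iff₀ (geomMGF_denom_pos hw hw1 hs)]
  refine le_trans ?_ (mul_le_mul_of_nonneg_left h hpos)
  have h3 : w * s ≤ 1 / 4 := by nlinarith
  have h4 : w * s ^ 2 ≤ 1 / 16 := by nlinarith [sq_nonneg s]
  -- The surplus over `1` in the product `(1 + w s + 4 w s²) (1 - w (s + s²))`.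
  have h5 : 0 ≤ w * s ^ 2 * (3 - w - 5 * (w * s) - 4 * (w * s ^ 2)) := by
    apply mul_nonneg (by positivity)
    linarith
  nlinarith

/-- The moment generating function of an inverse-probability-weighted geometric variable. -/
theorem weighted_geomMGF_le {w p lam d : ℝ} (hw : 0 < w) (hw1 : w ≤ 1) (hp : 0 < p)
    (hs : |lam / p| ≤ 1 / 4) (hd : 4 * lam ^ 2 / p ≤ d) :
    (p * geomMGF w (lam / p) + (1 - p)) * Real.exp (-(lam * w) - d) ≤ 1 := by
  have h1 : p * geomMGF w (lam / p) ≤ p * (1 + w * (lam / p) + 4 * w * (lam / p) ^ 2) :=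
    mul_le_mul_of_nonneg_left (geomMGF_le hw hw1 hs) hp.le
  have h2 : p * (1 + w * (lam / p) + 4 * w * (lam / p) ^ 2) =
      p + w * lam + w * (4 * lam ^ 2 / p) := by
    field_simp
  have h3 : w * (4 * lam ^ 2 / p) ≤ d :=
    (mul_le_of_le_one_left (by positivity) hw1).trans hd
  have h4 : p * geomMGF w (lam / p) + (1 - p) ≤ Real.exp (lam * w + d) :=
    le_trans (by linarith) (Real.add_one_le_exp (lam * w + d))
  calc _ ≤ Real.exp (lam * w + d) * Real.exp (-(lam * w) - d) :=
        mul_le_mul_of_nonneg_right h4 (Real.exp_pos _).le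
    _ = 1 := by rw [← Real.exp_add, ← Real.exp_zero]; congr 1; ring

theorem exploreProb_le_half {α : ℝ} (hα : 0 ≤ α) (n : ℕ) : exploreProb α (n + 1) ≤ 1 / 2 := by
  have h1 : (1 : ℝ) ≤ ((n + 1 : ℕ) : ℝ) ^ α :=
    Real.one_le_rpow (by exact_mod_cast Nat.le_add_left 1 n) hα
  unfold exploreProb
  exact div_le_div_of_nonneg_left (by norm_num) (by norm_num) (by linarith)

/-- The exploration probability decreases in the epoch index and never exceeds `1 / 2`, so the worst
case is exploration in epoch `T`. -/
theorem le_inclusionProb {N : ℕ} {α : ℝ} (hα : 0 ≤ α) {n T : ℕ} (hn : n < T)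
    (O : Finset (Fin N)) (i : Fin N) :
    1 / (2 * (T : ℝ) ^ α) ≤ inclusionProb α (n + 1) O i := by
  have h1 : 1 / (2 * (T : ℝ) ^ α) ≤ exploreProb α (n + 1) := by
    unfold exploreProb
    refine div_le_div_of_nonneg_left (by norm_num) (by positivity) ?_
    refine mul_le_mul_of_nonneg_left ?_ (by norm_num)
    exact Real.rpow_le_rpow (by positivity) (by exact_mod_cast hn) hα
  have h2 := exploreProb_le_half hα n
  unfold inclusionProb
  split_ifs <;> linarith

theorem inclusionProb_nonneg {N : ℕ} {α : ℝ} (hα : 0 ≤ α) (n : ℕ) (O : Finset (Fin N))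
    (i : Fin N) : 0 ≤ inclusionProb α (n + 1) O i :=
  (by positivity : (0 : ℝ) ≤ 1 / (2 * ((n + 1 : ℕ) : ℝ) ^ α)).trans
    (le_inclusionProb hα n.lt_succ_self O i)

/-! ### The exponential supermartingale of an item -/

section Item

variable {N : ℕ} (v : Fin N → ℝ) (α : ℝ) (i : Fin N) (lam d M : ℝ) (T : ℕ)

/-- The exponential of the centered cumulative estimator, with drift `d` per epoch. -/
noncomputable def expDeviation (h : History N) : ℝ :=
  Real.exp (lam * (sumV α h i - h.length * v i) - d * h.length)

/-- The exponential deviation reached the level `M` at the end of some epoch. -/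
def Exceeds : History N → Prop
  | [] => False
  | e :: h => Exceeds h ∨ M ≤ expDeviation v α i lam d (e :: h)

/-- The conditional expectation of the factor that the running epoch `e`, preceded by `n`
completed ones, contributes to the exponential deviation. -/
noncomputable def epochFactor (n : ℕ) (e : Epoch N) : ℝ :=
  (if i ∈ e.offered then
    Real.exp (lam / inclusionProb α (n + 1) e.optimistic i * e.count i) *
      geomMGF (v i) (lam / inclusionProb α (n + 1) e.optimistic i) else 1) *
    Real.exp (-(lam * v i) - d)

open Classical in
/-- The exponential supermartingale, stopped when it reaches `M` and killed after `T` epochs. -/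
noncomputable def potential (s : State N) : ℝ≥0∞ :=
  -- The bound `2 * T ^ α` on the weights is available only up to epoch `T`.
  if T ≤ s.past.length then 0
  else if Exceeds v α i lam d M s.past then ENNReal.ofReal M
  else ENNReal.ofReal
    (expDeviation v α i lam d s.past * epochFactor v α i lam d s.past.length s.current)

theorem expDeviation_cons_of_mem {e : Epoch N} (h : History N) (he : i ∈ e.offered) :
    expDeviation v α i lam d (e :: h) = expDeviation v α i lam d h *
      (Real.exp (lam / inclusionProb α (h.length + 1) e.optimistic i * e.count i) *
        Real.exp (-(lam * v i) - d)) := by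
  simp only [expDeviation, sumV, if_pos he, ← Real.exp_add, List.length_cons]
  congr 1
  push_cast
  ring

theorem expDeviation_cons_of_notMem {e : Epoch N} (h : History N) (he : i ∉ e.offered) :
    expDeviation v α i lam d (e :: h) = expDeviation v α i lam d h *
      Real.exp (-(lam * v i) - d) := by
  simp only [expDeviation, sumV, if_neg he, ← Real.exp_add, List.length_cons]
  congr 1
  push_cast
  ring

variable {v α i lam d M T}

/-- Item `i` lies in exactly one of `sel h` and its complement, so the coin offers it with
probability `inclusionProb`. Averaging the epoch factor over the coin is then the situation of
`weighted_geomMGF_le`. -/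
theorem pexp_newEpoch_potential_le (hα : 0 ≤ α) (sel : History N → Finset (Fin N))
    (hv : 0 < v i) (hv1 : v i ≤ 1) (hT : 0 < T)
    (hlam : |lam| * (2 * (T : ℝ) ^ α) ≤ 1 / 4) (hd : 8 * lam ^ 2 * (T : ℝ) ^ α ≤ d)
    (h : History N) (hM : ¬ Exceeds v α i lam d M h) :
    pexp (newEpoch α hα sel h) (potential v α i lam d M T) ≤
      ENNReal.ofReal (expDeviation v α i lam d h) := by
  rw [pexp_newEpoch]
  by_cases hl : T ≤ h.length
  · simp [potential, hl]
  simp only [potential, hl, hM, if_false, epochFactor, Finset.mem_compl, Epoch.count,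
    List.count_nil, Nat.cast_zero, mul_zero, Real.exp_zero, one_mul]
  obtain ⟨ha0, ha1⟩ := exploreProb_mem hα h.length
  have hTα : (0 : ℝ) < (T : ℝ) ^ α := Real.rpow_pos_of_pos (by exact_mod_cast hT) α
  have hple := le_inclusionProb hα (not_le.1 hl) (sel h) i
  set p := inclusionProb α (h.length + 1) (sel h) i with hp
  set G := expDeviation v α i lam d h
  have hG : 0 < G := Real.exp_pos _
  have hp0 : 0 < p := lt_of_lt_of_le (by positivity) hple
  have hinv : 1 / p ≤ 2 * (T : ℝ) ^ α := by
    rw [div_le_iff₀ hp0]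
    rw [div_le_iff₀ (by positivity)] at hple
    linarith
  have hs : |lam / p| ≤ 1 / 4 := by
    rw [abs_div, abs_of_pos hp0, div_eq_mul_one_div]
    exact (mul_le_mul_of_nonneg_left hinv (abs_nonneg _)).trans hlam
  have hd' : 4 * lam ^ 2 / p ≤ d := by
    rw [div_eq_mul_one_div]
    refine (mul_le_mul_of_nonneg_left hinv (by positivity)).trans (le_trans (le_of_eq ?_) hd)
    ring
  have hg : 0 ≤ geomMGF (v i) (lam / p) := (one_div_pos.2 (geomMGF_denom_pos hv hv1 hs)).le
  have key := weighted_geomMGF_le hv hv1 hp0 hs hd'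
  have hX := Real.exp_pos (-(lam * v i) - d)
  have := mul_le_mul_of_nonneg_left key hG.le
  have ha1' := sub_nonneg.2 ha1
  by_cases hi : i ∈ sel h
  · simp only [hi, not_true_eq_false, if_true, if_false]
    rw [← ENNReal.ofReal_mul ha0, ← ENNReal.ofReal_mul ha1',
      ← ENNReal.ofReal_add (by positivity) (by positivity)]
    apply ENNReal.ofReal_le_ofReal
    have hpe : exploreProb α (h.length + 1) = 1 - p := by rw [hp, inclusionProb, if_pos hi]; ring
    rw [hpe]
    linarith
  · simp only [hi, not_false_eq_true, if_true, if_false]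
    rw [← ENNReal.ofReal_mul ha0, ← ENNReal.ofReal_mul ha1',
      ← ENNReal.ofReal_add (by positivity) (by positivity)]
    apply ENNReal.ofReal_le_ofReal
    have hpe : exploreProb α (h.length + 1) = p := by rw [hp, inclusionProb, if_neg hi]
    rw [hpe]
    linarith

theorem pexp_newEpoch_potential_le_level (hα : 0 ≤ α) (sel : History N → Finset (Fin N))
    (h : History N) (hM : Exceeds v α i lam d M h) :
    pexp (newEpoch α hα sel h) (potential v α i lam d M T) ≤ ENNReal.ofReal M := by
  obtain ⟨ha0, ha1⟩ := exploreProb_mem hα h.length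
  rw [pexp_newEpoch]
  by_cases hl : T ≤ h.length
  · simp [potential, hl]
  simp only [potential, hl, hM, if_false, if_true]
  rw [← add_mul, ← ENNReal.ofReal_add ha0 (sub_nonneg.2 ha1)]
  simp

/-- Within an epoch this is memorylessness: the purchases of `i` still to come are again geometric,
so `epochFactor` is preserved on average. At the end of an epoch the new coin toss can only lower
the expectation. -/
theorem pexp_step_potential_le (hα : 0 ≤ α) (sel : History N → Finset (Fin N))
    (hv : ∀ j, 0 < v j) (hv1 : v i ≤ 1) (hT : 0 < T)
    (hlam : |lam| * (2 * (T : ℝ) ^ α) ≤ 1 / 4) (hd : 8 * lam ^ 2 * (T : ℝ) ^ α ≤ d)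
    (s : State N) :
    pexp (step v hv α hα sel s) (potential v α i lam d M T) ≤ potential v α i lam d M T s := by
  obtain ⟨h, e⟩ := s
  rw [pexp_step]
  by_cases hl : T ≤ h.length
  · have hl' : T ≤ h.length + 1 := hl.trans (Nat.le_succ _)
    refine (pexp_mono _ (g := fun _ => 0) fun c => ?_).trans (by simp [pexp])
    rcases c with _ | j
    · simp [pexp_newEpoch, potential, hl']
    · simp [potential, hl]
  by_cases hM : Exceeds v α i lam d M h
  · have : potential v α i lam d M T ⟨h, e⟩ = ENNReal.ofReal M := by simp [potential, hl, hM]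
    rw [this, ← pexp_const (choice v hv e.offered) (ENNReal.ofReal M)]
    refine pexp_mono _ fun c => ?_
    rcases c with _ | j
    · exact pexp_newEpoch_potential_le_level hα sel _ (Or.inl hM)
    · simp [potential, hl, hM]
  have hTα : (0 : ℝ) < (T : ℝ) ^ α := Real.rpow_pos_of_pos (by exact_mod_cast hT) α
  have hple := le_inclusionProb hα (not_le.1 hl) e.optimistic i
  have hp0 : 0 < inclusionProb α (h.length + 1) e.optimistic i :=
    lt_of_lt_of_le (by positivity) hple
  have hinv : 1 / inclusionProb α (h.length + 1) e.optimistic i ≤ 2 * (T : ℝ) ^ α := by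
    rw [div_le_iff₀ hp0]
    rw [div_le_iff₀ (by positivity)] at hple
    linarith
  have hs : |lam / inclusionProb α (h.length + 1) e.optimistic i| ≤ 1 / 4 := by
    rw [abs_div, abs_of_pos hp0, div_eq_mul_one_div]
    exact (mul_le_mul_of_nonneg_left hinv (abs_nonneg _)).trans hlam
  have hg := geomMGF_denom_pos (hv i) hv1 hs
  have hnone : pexp (newEpoch α hα sel (e :: h)) (potential v α i lam d M T) ≤
      ENNReal.ofReal (expDeviation v α i lam d (e :: h)) := by
    -- If this epoch is the first to reach the level, the frozen value `M` is at most the deviation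
    -- attained.
    by_cases hM' : Exceeds v α i lam d M (e :: h)
    · exact (pexp_newEpoch_potential_le_level hα sel _ hM').trans
        (ENNReal.ofReal_le_ofReal (hM'.resolve_left hM))
    · exact pexp_newEpoch_potential_le hα sel (hv i) hv1 hT hlam hd _ hM'
  have hF0 : ∀ P, 0 ≤ epochFactor v α i lam d h.length { e with purchases := P } := by
    intro P
    simp only [epochFactor, geomMGF]
    refine mul_nonneg ?_ (Real.exp_pos _).le
    split_ifs
    · positivity
    · norm_num
  have hG : 0 < expDeviation v α i lam d h := Real.exp_pos _
  refine (pexp_mono _ (g := fun c => ENNReal.ofReal (Option.elim c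
    (expDeviation v α i lam d (e :: h)) fun j => expDeviation v α i lam d h *
      epochFactor v α i lam d h.length { e with purchases := j :: e.purchases }))
      fun c => ?_).trans ?_
  · rcases c with _ | j
    · exact hnone
    · simp [potential, hl, hM]
  rw [pexp_choice_ofReal _ _ _ _ (by
    rintro (_ | j)
    · exact (Real.exp_pos _).le
    · exact mul_nonneg hG.le (hF0 _))]
  simp only [potential, hl, hM, if_false]
  apply ENNReal.ofReal_le_ofReal
  have hV : 0 ≤ ∑ j ∈ e.offered, v j := Finset.sum_nonneg fun j _ => (hv j).le
  rw [div_le_iff₀ (by linarith)]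
  apply le_of_eq
  simp only [Option.elim]
  by_cases hi : i ∈ e.offered
  · rw [expDeviation_cons_of_mem v α i lam d h hi]
    simp only [epochFactor, hi, if_true, Epoch.count]
    set σ := lam / inclusionProb α (h.length + 1) e.optimistic i
    rw [← Finset.add_sum_erase _ _ hi, ← Finset.add_sum_erase _ v hi]
    have hrest : ∀ j ∈ e.offered.erase i, v j * (expDeviation v α i lam d h *
        (Real.exp (σ * ((j :: e.purchases).count i : ℕ)) * geomMGF (v i) σ *
          Real.exp (-(lam * v i) - d))) =
        v j * (expDeviation v α i lam d h *
        (Real.exp (σ * (e.purchases.count i : ℕ)) * geomMGF (v i) σ *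
          Real.exp (-(lam * v i) - d))) := by
      intro j hj
      rw [List.count_cons_of_ne (Finset.ne_of_mem_erase hj)]
    rw [Finset.sum_congr rfl hrest, ← Finset.sum_mul, List.count_cons_self, Nat.cast_add,
      Nat.cast_one, mul_add, mul_one, Real.exp_add]
    -- First-step equation of the geometric law; it makes the step an exact equality.
    have hgm : geomMGF (v i) σ * (1 + v i - v i * Real.exp σ) = 1 := by
      rw [geomMGF, one_div, inv_mul_cancel₀ hg.ne']
    linear_combination (-(expDeviation v α i lam d h * (Real.exp (σ * (e.purchases.count i : ℕ)) *
      Real.exp (-(lam * v i) - d)))) * hgm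
  · rw [expDeviation_cons_of_notMem v α i lam d h hi]
    simp only [epochFactor, hi, if_false]
    rw [← Finset.sum_mul]
    ring

/-- A maximal inequality for the exponential deviation of an item. -/
theorem law_exceeds_le (hα : 0 ≤ α) (sel : History N → Finset (Fin N))
    (hv : ∀ j, 0 < v j) (hv1 : v i ≤ 1) (hT : 0 < T) (hM : 0 < M)
    (hlam : |lam| * (2 * (T : ℝ) ^ α) ≤ 1 / 4) (hd : 8 * lam ^ 2 * (T : ℝ) ^ α ≤ d) :
    law v hv α hα sel T {s | Exceeds v α i lam d M s.past} ≤ ENNReal.ofReal (1 / M) := by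
  have h0 : pexp (newEpoch α hα sel []) (potential v α i lam d M T) ≤ 1 := by
    refine (pexp_newEpoch_potential_le hα sel (hv i) hv1 hT hlam hd [] id).trans ?_
    simp [expDeviation, sumV]
  have key := pexp_run_le v hv α hα sel (K := 1) (B := 1) h0
    (fun s => by rw [one_mul]; exact pexp_step_potential_le hα sel hv hv1 hT hlam hd s) (T - 1)
  rw [one_pow, one_mul] at key
  have hmk := mul_toMeasure_le_pexp (run v hv α hα sel (T - 1)) (potential v α i lam d M T)
    (A := {s | Exceeds v α i lam d M s.past ∧ s.past.length < T}) (by trivial) (ENNReal.ofReal M)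
    (fun s hs => by simp [potential, hs.1, not_le.2 hs.2])
  have hsub : law v hv α hα sel T {s | Exceeds v α i lam d M s.past} ≤
      law v hv α hα sel T {s | Exceeds v α i lam d M s.past ∧ s.past.length < T} := by
    have hnull : law v hv α hα sel T {s | T ≤ s.past.length} = 0 := by
      rw [law, PMF.toMeasure_apply_eq_zero_iff _ (by trivial), Set.disjoint_left]
      intro s hs hs'
      have := length_le_of_mem_support_run v hv α hα sel hs
      simp only [Set.mem_ofPred_eq] at hs'
      omega
    calc _ ≤ law v hv α hα sel T ({s | Exceeds v α i lam d M s.past ∧ s.past.length < T} ∪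
          {s | T ≤ s.past.length}) := MeasureTheory.measure_mono fun s hs => by
            rcases lt_or_ge s.past.length T with hl | hl
            · exact Or.inl ⟨hs, hl⟩
            · exact Or.inr hl
      _ ≤ _ := MeasureTheory.measure_union_le _ _
      _ = _ := by rw [hnull, add_zero]
  refine hsub.trans ?_
  rw [one_div, ENNReal.ofReal_inv_of_pos hM]
  rw [ENNReal.le_inv_iff_mul_le, mul_comm]
  exact hmk.trans key

end Item

/-! ### Sensitivity of the revenue -/

theorem revenue_mem_Icc {N : ℕ} {r : Fin N → ℝ} (hr0 : ∀ i, 0 ≤ r i) (hr1 : ∀ i, r i ≤ 1)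
    {w : Fin N → ℝ} (hw : ∀ i, 0 ≤ w i) (S : Finset (Fin N)) :
    revenue r w S ∈ Set.Icc (0 : ℝ) 1 := by
  have h0 : 0 ≤ ∑ j ∈ S, w j := Finset.sum_nonneg fun j _ => hw j
  have h1 : 0 ≤ ∑ i ∈ S, r i * w i := Finset.sum_nonneg fun j _ => mul_nonneg (hr0 j) (hw j)
  have h2 : ∑ i ∈ S, r i * w i ≤ ∑ j ∈ S, w j :=
    Finset.sum_le_sum fun j _ => mul_le_of_le_one_left (hw j) (hr1 j)
  constructor
  · unfold revenue; positivity
  · unfold revenue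
    rw [div_le_one (by positivity)]
    linarith

/-- The difference equals `∑ (r i - R(v)) (w i - v i) / (1 + ∑ w j)` over `S`. The coefficients `r i
- R(v)` lie in `[-1, 1]`, and the denominator is at least `1`. -/
theorem abs_revenue_sub_le {N : ℕ} {r : Fin N → ℝ} (hr0 : ∀ i, 0 ≤ r i) (hr1 : ∀ i, r i ≤ 1)
    {w v : Fin N → ℝ} (hw : ∀ i, 0 ≤ w i) (hv : ∀ i, 0 ≤ v i)
    (S : Finset (Fin N)) :
    |revenue r w S - revenue r v S| ≤ ∑ i, |w i - v i| := by
  obtain ⟨hR0, hR1⟩ := revenue_mem_Icc hr0 hr1 hv S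
  have h0 : 0 ≤ ∑ j ∈ S, w j := Finset.sum_nonneg fun j _ => hw j
  have h0' : 0 ≤ ∑ j ∈ S, v j := Finset.sum_nonneg fun j _ => hv j
  have hR : revenue r v S * (1 + ∑ j ∈ S, v j) = ∑ i ∈ S, r i * v i :=
    div_mul_cancel₀ _ (by positivity)
  have key : revenue r w S - revenue r v S =
      (∑ i ∈ S, (r i - revenue r v S) * (w i - v i)) / (1 + ∑ j ∈ S, w j) := by
    rw [eq_div_iff (by positivity), sub_mul, revenue.eq_1 r w S, div_mul_cancel₀ _ (by positivity)]
    simp only [sub_mul, mul_sub, Finset.sum_sub_distrib, ← Finset.mul_sum]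
    linarith
  rw [key, abs_div, abs_of_pos (by positivity : 0 < 1 + ∑ j ∈ S, w j)]
  refine (div_le_self (abs_nonneg _) (by linarith)).trans ?_
  refine (Finset.abs_sum_le_sum_abs _ _).trans ?_
  refine (Finset.sum_le_sum fun i _ => ?_).trans
    (Finset.sum_le_sum_of_subset_of_nonneg (Finset.subset_univ S) fun i _ _ => abs_nonneg _)
  rw [abs_mul]
  refine mul_le_of_le_one_left (abs_nonneg _) (abs_le.2 ⟨?_, ?_⟩) <;>
    linarith [hr0 i, hr1 i]

theorem sumV_nonneg {N : ℕ} {α : ℝ} (hα : 0 ≤ α) (h : History N) (i : Fin N) : 0 ≤ sumV α h i := by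
  induction h with
  | nil => simp [sumV]
  | cons e h ih =>
    rw [sumV]
    have := inclusionProb_nonneg hα h.length e.optimistic i
    split_ifs <;> positivity

theorem diffError_le_two {N : ℕ} {r : Fin N → ℝ} (hr0 : ∀ i, 0 ≤ r i) (hr1 : ∀ i, r i ≤ 1)
    {v : Fin N → ℝ} (hv : ∀ i, 0 ≤ v i) {α : ℝ} (hα : 0 ≤ α)
    (S S' : Finset (Fin N)) (s : State N) : diffError v r α S S' s ≤ 2 := by
  have hw : ∀ i, 0 ≤ estimate α s.past i := fun i =>
    div_nonneg (sumV_nonneg hα _ _) (Nat.cast_nonneg _)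
  obtain ⟨h1, h2⟩ := revenue_mem_Icc hr0 hr1 hw S
  obtain ⟨h3, h4⟩ := revenue_mem_Icc hr0 hr1 hw S'
  obtain ⟨h5, h6⟩ := revenue_mem_Icc hr0 hr1 hv S
  obtain ⟨h7, h8⟩ := revenue_mem_Icc hr0 hr1 hv S'
  unfold diffError
  rw [abs_le]
  constructor <;> linarith

theorem diffError_le_sum {N : ℕ} {r : Fin N → ℝ} (hr0 : ∀ i, 0 ≤ r i) (hr1 : ∀ i, r i ≤ 1)
    {v : Fin N → ℝ} (hv : ∀ i, 0 ≤ v i) {α : ℝ} (hα : 0 ≤ α)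
    (S S' : Finset (Fin N)) (s : State N) :
    diffError v r α S S' s ≤ 2 * ∑ i, |estimate α s.past i - v i| := by
  have hw : ∀ i, 0 ≤ estimate α s.past i := fun i =>
    div_nonneg (sumV_nonneg hα _ _) (Nat.cast_nonneg _)
  have h1 := abs_le.1 (abs_revenue_sub_le hr0 hr1 hw hv S)
  have h2 := abs_le.1 (abs_revenue_sub_le hr0 hr1 hw hv S')
  unfold diffError
  rw [abs_le]
  constructor <;> linarith

/-! ### Concentration of the estimates -/

theorem expDeviation_lt_of_not_exceeds {N : ℕ} {v : Fin N → ℝ} {α : ℝ} {i : Fin N} {lam d M : ℝ}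
    {h : History N} (hh : h ≠ []) (hM : ¬ Exceeds v α i lam d M h) :
    expDeviation v α i lam d h < M := by
  cases h with
  | nil => exact absurd rfl hh
  | cons e h => exact not_le.1 fun hle => hM (Or.inr hle)

/-- Taking logarithms of the two deviations bounds the centered sum from both sides. The empty
history is excluded because `Exceeds` is false there by definition. -/
theorem abs_estimate_sub_le {N : ℕ} {v : Fin N → ℝ} {α : ℝ} {i : Fin N} {lam d M : ℝ}
    (hlam : 0 < lam) {h : History N} (hh : h ≠ []) (h1 : ¬ Exceeds v α i lam d M h)
    (h2 : ¬ Exceeds v α i (-lam) d M h) :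
    |estimate α h i - v i| ≤ Real.log M / (lam * h.length) + d / lam := by
  have h1' := expDeviation_lt_of_not_exceeds hh h1
  have h2' := expDeviation_lt_of_not_exceeds hh h2
  have hM : 0 < M := (Real.exp_pos _).trans h1'
  rw [expDeviation, ← Real.lt_log_iff_exp_lt hM] at h1' h2'
  have hL : (0 : ℝ) < h.length := by exact_mod_cast List.length_pos_iff.2 hh
  have e1 : estimate α h i - v i = (sumV α h i - h.length * v i) / h.length := by
    rw [estimate]; field_simp
  have e2 : Real.log M / (lam * h.length) + d / lam =
      (Real.log M + d * h.length) / lam / h.length := by field_simp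
  rw [e1, e2, abs_div, abs_of_pos hL]
  refine div_le_div_of_nonneg_right ?_ hL.le
  have e3 : |sumV α h i - h.length * v i| * lam = |(sumV α h i - h.length * v i) * lam| := by
    rw [abs_mul, abs_of_pos hlam]
  rw [le_div_iff₀ hlam, e3, abs_le]
  constructor <;> linarith

/-- Split `4 N / δ = (2 N) (2 / δ)` and use `2 N ≤ 2 ^ N` and `log 2 ≤ log (2 / δ)`; the sum is at
most `(N + 1) log (2 / δ)`. -/
theorem log_four_mul_div_le {N : ℕ} (hN : 0 < N) {δ : ℝ} (hδ : 0 < δ) (hδ1 : δ < 1) :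
    Real.log (4 * N / δ) ≤ 2 * N * Real.log (2 / δ) := by
  have hE : Real.log 2 ≤ Real.log (2 / δ) :=
    Real.log_le_log (by norm_num) (by rw [le_div_iff₀ hδ]; linarith)
  have hNr : (1 : ℝ) ≤ N := by exact_mod_cast hN
  have h1 : 4 * (N : ℝ) / δ = (2 * N) * (2 / δ) := by ring
  have h2 : (2 * N : ℝ) ≤ 2 ^ N := by
    obtain ⟨k, rfl⟩ : ∃ k, N = k + 1 := ⟨N - 1, by omega⟩
    have : k + 1 ≤ 2 ^ k := Nat.lt_two_pow_self
    rw [pow_succ, mul_comm]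
    exact mul_le_mul_of_nonneg_right (by exact_mod_cast this) (by norm_num)
  rw [h1, Real.log_mul (by positivity) (by positivity)]
  have h3 : Real.log (2 * N) ≤ N * Real.log 2 := by
    rw [← Real.log_pow]
    exact Real.log_le_log (by positivity) h2
  have h4 : (N : ℝ) * Real.log 2 ≤ N * Real.log (2 / δ) := mul_le_mul_of_nonneg_left hE (by linarith)
  have h5 : 0 < Real.log (2 / δ) := lt_of_lt_of_le (Real.log_pos (by norm_num)) hE
  nlinarith

/-- From `exp (-1) ≤ 2 / 5` and `N + 1 ≤ 2 N`, each step gains `exp (-3 / (10 N))`. Against `exp (T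
/ (4 N))` this leaves the rate `T / (20 N)`, which exceeds `log (2 / δ)` with room for the missing
step in `T - 1`. -/
theorem epoch_tail_le {N T : ℕ} (hN : 0 < N) (hT : 1 ≤ T) {δ : ℝ} (hδ : 0 < δ)
    (hE : 1 / 2 ≤ Real.log (2 / δ)) (hTN : 800 * Real.log (2 / δ) ≤ (T : ℝ) / N) :
    Real.exp ((T : ℝ) / (4 * N)) * (1 - (1 - Real.exp (-1)) / (N + 1)) ^ (T - 1) ≤ δ / 2 := by
  have hNr : (1 : ℝ) ≤ N := by exact_mod_cast hN
  have he : Real.exp (-1) ≤ 2 / 5 := by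
    rw [Real.exp_neg, inv_le_comm₀ (Real.exp_pos _) (by norm_num)]
    linarith [Real.exp_one_gt_d9]
  have h1 : 3 / 10 / (N : ℝ) ≤ (1 - Real.exp (-1)) / (N + 1) := by
    rw [div_le_div_iff₀ (by linarith) (by linarith)]
    nlinarith
  have hK0 : 0 ≤ 1 - (1 - Real.exp (-1)) / ((N : ℝ) + 1) := by
    rw [sub_nonneg, div_le_one (by positivity)]
    have := Real.exp_pos (-1)
    linarith
  have hK : 1 - (1 - Real.exp (-1)) / ((N : ℝ) + 1) ≤ Real.exp (-(3 / 10 / (N : ℝ))) := by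
    have := Real.add_one_le_exp (-(3 / 10 / (N : ℝ)))
    linarith
  have hpow := pow_le_pow_left₀ hK0 hK (T - 1)
  rw [← Real.exp_nat_mul] at hpow
  refine (mul_le_mul_of_nonneg_left hpow (Real.exp_pos _).le).trans ?_
  rw [← Real.exp_add]
  have hδE : δ / 2 = Real.exp (-Real.log (2 / δ)) := by
    rw [← Real.log_inv, Real.exp_log (by positivity), inv_div]
  rw [hδE]
  apply Real.exp_le_exp.2
  rw [Nat.cast_sub hT]
  have e1 : (T : ℝ) / (4 * N) + ((T : ℝ) - (1 : ℕ)) * -(3 / 10 / (N : ℝ)) =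
      -(1 / 20) * ((T : ℝ) / N) + 3 / 10 / N := by
    push_cast
    field_simp
    ring
  have e2 : 3 / 10 / (N : ℝ) ≤ 3 / 10 := div_le_self (by norm_num) hNr
  rw [e1]
  linarith

/-- If the claimed bound is nontrivial, then with probability at least `1 - δ` it holds for the
estimates of all items. -/
theorem law_estimate_error_le {N : ℕ} (hN : 0 < N) (v : Fin N → ℝ) (hv : ∀ i, 0 < v i)
    (hv1 : ∀ i, v i ≤ 1) {α : ℝ} (hα : 0 ≤ α) (hα1 : α ≤ 1 / 2)
    (sel : History N → Finset (Fin N)) {T : ℕ} (hT : 1 ≤ T) {δ : ℝ} (hδ : 0 < δ) (hδ1 : δ < 1)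
    (hsmall : 36 * Real.log (2 / δ) * (N : ℝ) ^ 2 * ((N : ℝ) / T) ^ ((1 - α) / 2) < 1) :
    law v hv α hα sel T {s | ¬ ∀ i, |estimate α s.past i - v i| ≤
      36 * Real.log (2 / δ) * N * ((N : ℝ) / T) ^ ((1 - α) / 2)} ≤ ENNReal.ofReal δ := by
  have hNr : (1 : ℝ) ≤ N := by exact_mod_cast hN
  have hTr : (1 : ℝ) ≤ T := by exact_mod_cast hT
  have hE : 0.69 ≤ Real.log (2 / δ) := by
    have : Real.log 2 ≤ Real.log (2 / δ) :=
      Real.log_le_log (by norm_num) (by rw [le_div_iff₀ hδ]; linarith)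
    linarith [Real.log_two_gt_d9]
  have hlogM := log_four_mul_div_le hN hδ hδ1
  set E := Real.log (2 / δ) with hEdef
  set x := ((N : ℝ) / T) ^ ((1 - α) / 2) with hx
  set ρ := (1 / (T : ℝ)) ^ ((1 - α) / 2) with hρ
  have hρ0 : 0 < ρ := by positivity
  have hρx : ρ ≤ x := Real.rpow_le_rpow (by positivity)
    (div_le_div_of_nonneg_right hNr (by positivity)) (by linarith)
  have hρT : (T : ℝ) ^ α = T * ρ ^ 2 := by
    rw [hρ, ← Real.rpow_natCast, ← Real.rpow_mul (by positivity), one_div,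
      Real.inv_rpow (by positivity), ← Real.rpow_neg (by positivity)]
    nth_rewrite 2 [← Real.rpow_one (T : ℝ)]
    rw [← Real.rpow_add (by positivity)]
    congr 1
    push_cast
    ring
  have hN2 : (N : ℝ) ≤ (N : ℝ) ^ 2 := by nlinarith
  have hx0 : 0 < x := lt_of_lt_of_le hρ0 hρx
  have hEN : 36 * 0.69 * (N : ℝ) ≤ 36 * E * (N : ℝ) ^ 2 :=
    mul_le_mul (by linarith) hN2 (by linarith) (by linarith)
  have hNρ : 8 * (N * ρ) ≤ 1 := by
    have := mul_le_mul hEN hρx hρ0.le (by positivity)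
    nlinarith [mul_pos (by linarith : (0 : ℝ) < N) hρ0]
  -- the horizon is long
  have hTN : 800 * E ≤ (T : ℝ) / N := by
    have hx1 : x < 1 := by
      have : 1 ≤ 36 * E * (N : ℝ) ^ 2 := by linarith
      nlinarith
    have hNT : (N : ℝ) / T < 1 := by
      by_contra hcon
      exact absurd hx1 (not_lt.2 (Real.one_le_rpow (not_lt.1 hcon) (by linarith)))
    have hxx : (N : ℝ) / T ≤ x ^ 2 := by
      rw [hx, ← Real.rpow_natCast, ← Real.rpow_mul (by positivity)]
      nth_rewrite 1 [← Real.rpow_one ((N : ℝ) / T)]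
      apply Real.rpow_le_rpow_of_exponent_ge (by positivity) hNT.le
      push_cast
      linarith
    have h36 : 36 * E * x < 1 := by
      have : 36 * E * x ≤ 36 * E * (N : ℝ) ^ 2 * x := by
        refine mul_le_mul_of_nonneg_right ?_ hx0.le
        exact le_mul_of_one_le_right (by linarith) (by linarith)
      linarith
    -- Squaring `36 E x < 1` suffices, as `36² · 0.69 > 800`.
    have h3 : 800 * E * ((N : ℝ) / T) ≤ 1 := by
      have : 800 * E * ((N : ℝ) / T) ≤ 800 * E * x ^ 2 :=
        mul_le_mul_of_nonneg_left hxx (by linarith)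
      have h4 : (36 * E * x) * (36 * E * x) ≤ 1 := by
        have : 0 ≤ 36 * E * x := by positivity
        nlinarith
      have h5 : 0 ≤ E * x ^ 2 := by positivity
      nlinarith
    rw [le_div_iff₀ (by positivity)]
    have : 800 * E * ((N : ℝ) / T) = 800 * E * N / T := by ring
    rw [this, div_le_one (by positivity)] at h3
    exact h3
  -- The `2 N` events (items and signs) cost `δ / (4 N)` each, `δ / 2` in total; the other half pays
  -- for too few epochs.
  set M := 4 * (N : ℝ) / δ with hM
  -- This makes both error terms of order `N ρ`: `8 E N ρ` from the level, once `L > T / (4 N)`, and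
  -- `8 N ρ ≤ 28 E N ρ` from the drift. Together they give the constant `36`.
  set lam := (N : ℝ) / (T * ρ) with hlam
  have hM0 : 0 < M := by positivity
  have hlam0 : 0 < lam := by positivity
  have hlamT : lam * (T : ℝ) ^ α = N * ρ := by
    rw [hρT, hlam]
    field_simp
  set d := 8 * lam ^ 2 * (T : ℝ) ^ α with hd
  have hdl : d / lam = 8 * (N * ρ) := by
    rw [← hlamT, hd]
    field_simp
  have hlam1 : |lam| * (2 * (T : ℝ) ^ α) ≤ 1 / 4 := by
    rw [abs_of_pos hlam0]
    linarith
  have hinv : 1 / M = δ / (4 * N) := by rw [hM, one_div_div]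
  have hb0 := (law_length_le v hv hv1 α hα sel T ((T : ℝ) / (4 * N))).trans
    (ENNReal.ofReal_le_ofReal (epoch_tail_le hN hT hδ (by linarith) hTN))
  have hb1 : ∀ i, law v hv α hα sel T {s | Exceeds v α i lam d M s.past} ≤
      ENNReal.ofReal (δ / (4 * N)) := fun i => by
    rw [← hinv]
    exact law_exceeds_le hα sel hv (hv1 i) hT hM0 hlam1 le_rfl
  have hb2 : ∀ i, law v hv α hα sel T {s | Exceeds v α i (-lam) d M s.past} ≤
      ENNReal.ofReal (δ / (4 * N)) := fun i => by
    rw [← hinv]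
    exact law_exceeds_le hα sel hv (hv1 i) hT hM0 (by rwa [abs_neg]) (by rw [neg_sq])
  have hsum : ∑ _i : Fin N, ENNReal.ofReal (δ / (4 * N)) = ENNReal.ofReal (δ / 4) := by
    rw [Finset.sum_const, Finset.card_univ, Fintype.card_fin, nsmul_eq_mul,
      ← ENNReal.ofReal_natCast, ← ENNReal.ofReal_mul (by positivity)]
    congr 1
    field_simp
  have hsub : {s : State N | ¬ ∀ i, |estimate α s.past i - v i| ≤ 36 * E * N * x} ⊆
      {s | (s.past.length : ℝ) ≤ (T : ℝ) / (4 * N)} ∪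
        ((⋃ i, {s | Exceeds v α i lam d M s.past}) ∪
          (⋃ i, {s | Exceeds v α i (-lam) d M s.past})) := by
    intro s hs
    by_contra hcon
    simp only [Set.mem_union, Set.mem_iUnion, Set.mem_ofPred_eq, not_or, not_exists,
      not_le] at hcon
    obtain ⟨hL, h1, h2⟩ := hcon
    refine hs fun i => ?_
    have hT4 : 0 < (T : ℝ) / (4 * N) := by positivity
    have hne : s.past ≠ [] := by
      intro h0
      rw [h0, List.length_nil, Nat.cast_zero] at hL
      linarith
    refine (abs_estimate_sub_le hlam0 hne (h1 i) (h2 i)).trans ?_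
    have h3 : Real.log M / (lam * s.past.length) ≤ 2 * N * E / (lam * (T / (4 * N))) := by
      refine div_le_div₀ (by positivity) hlogM (by positivity) ?_
      exact mul_le_mul_of_nonneg_left hL.le hlam0.le
    have h4 : 2 * N * E / (lam * (T / (4 * N))) = 8 * E * (N * ρ) := by
      rw [hlam]
      field_simp
      ring
    rw [hdl]
    have hNρ0 : 0 < N * ρ := by positivity
    have h5 : 8 * (N * ρ) ≤ 28 * E * (N * ρ) :=
      mul_le_mul_of_nonneg_right (by linarith) hNρ0.le
    have h6 : 36 * E * (N * ρ) ≤ 36 * E * (N * x) := by gcongr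
    linarith
  calc _ ≤ _ := MeasureTheory.measure_mono hsub
    _ ≤ ENNReal.ofReal (δ / 2) + (ENNReal.ofReal (δ / 4) + ENNReal.ofReal (δ / 4)) := by
      refine (MeasureTheory.measure_union_le _ _).trans (add_le_add hb0 ?_)
      refine (MeasureTheory.measure_union_le _ _).trans (add_le_add ?_ ?_) <;>
      refine (MeasureTheory.measure_iUnion_fintype_le _ _).trans ?_ <;>
      rw [← hsum]
      · exact Finset.sum_le_sum fun i _ => hb1 i
      · exact Finset.sum_le_sum fun i _ => hb2 i
    _ = ENNReal.ofReal δ := by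
      rw [← ENNReal.ofReal_add (by positivity) (by positivity),
        ← ENNReal.ofReal_add (by positivity) (by positivity)]
      congr 1
      ring

/-- The high-probability bound for the revenue differences. -/
theorem law_diffError_gt_le {N : ℕ} (v r : Fin N → ℝ) (hv : ∀ i, 0 < v i)
    (hv1 : ∀ i, v i ≤ 1) (hr0 : ∀ i, 0 ≤ r i) (hr1 : ∀ i, r i ≤ 1) {α : ℝ} (hα : 0 ≤ α)
    (hα1 : α ≤ 1 / 2) (sel : History N → Finset (Fin N)) {T : ℕ} (hT : 1 ≤ T) {δ : ℝ}
    (hδ : 0 < δ) (hδ1 : δ < 1) :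
    law v hv α hα sel T {s | ∀ S S', diffError v r α S S' s ≤
      72 * Real.log (2 / δ) * (N : ℝ) ^ 2 * ((N : ℝ) / T) ^ ((1 - α) / 2)}ᶜ ≤
        ENNReal.ofReal δ := by
  have hv0 : ∀ i, 0 ≤ v i := fun i => (hv i).le
  have hempty : (∀ s S S', diffError v r α S S' s ≤
      72 * Real.log (2 / δ) * (N : ℝ) ^ 2 * ((N : ℝ) / T) ^ ((1 - α) / 2)) →
      law v hv α hα sel T {s | ∀ S S', diffError v r α S S' s ≤
      72 * Real.log (2 / δ) * (N : ℝ) ^ 2 * ((N : ℝ) / T) ^ ((1 - α) / 2)}ᶜ ≤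
        ENNReal.ofReal δ := by
    intro h
    have : {s | ∀ S S', diffError v r α S S' s ≤
      72 * Real.log (2 / δ) * (N : ℝ) ^ 2 * ((N : ℝ) / T) ^ ((1 - α) / 2)}ᶜ = ∅ := by
      rw [Set.compl_empty_iff]
      exact Set.eq_univ_of_forall h
    rw [this]
    simp
  rcases Nat.eq_zero_or_pos N with rfl | hN
  · exact hempty fun s S S' => by simpa using diffError_le_sum hr0 hr1 hv0 hα S S' s
  -- Otherwise the claimed bound is at least `2`, which no difference of revenue differences
  -- exceeds.
  by_cases hsmall : 36 * Real.log (2 / δ) * (N : ℝ) ^ 2 * ((N : ℝ) / T) ^ ((1 - α) / 2) < 1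
  · refine le_trans (MeasureTheory.measure_mono ?_)
      (law_estimate_error_le hN v hv hv1 hα hα1 sel hT hδ hδ1 hsmall)
    intro s hs hall
    refine hs fun S S' => ?_
    refine (diffError_le_sum hr0 hr1 hv0 hα S S' s).trans ?_
    have := Finset.sum_le_sum fun i (_ : i ∈ Finset.univ) => hall i
    rw [Finset.sum_const, Finset.card_univ, Fintype.card_fin, nsmul_eq_mul] at this
    linarith
  · exact hempty fun s S S' => (diffError_le_two hr0 hr1 hv0 hα S S' s).trans (by linarith)

/-! ### From exponential tails to the expectation -/

/-- A random variable whose tails satisfy `P(X > A log (2 / δ)) ≤ δ` has mean at most `2 A`. -/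
theorem integral_le_of_tail {Ω : Type*} [MeasurableSpace Ω] {μ : MeasureTheory.Measure Ω}
    [MeasureTheory.IsProbabilityMeasure μ] {X : Ω → ℝ} (hX : MeasureTheory.Integrable X μ)
    (hX0 : ∀ ω, 0 ≤ X ω) {A : ℝ} (hA : 0 < A)
    (htail : ∀ δ : ℝ, 0 < δ → δ < 1 →
      μ {ω | A * Real.log (2 / δ) < X ω} ≤ ENNReal.ofReal δ) :
    ∫ ω, X ω ∂μ ≤ 2 * A := by
  rw [hX.integral_eq_integral_meas_lt (Filter.Eventually.of_forall hX0)]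
  have hA' : -(1 / A) < 0 := by simpa using hA
  have hint := (integrableOn_exp_mul_Ioi hA' 0).const_mul 2
  have hval : ∫ t in Set.Ioi (0 : ℝ), 2 * Real.exp (-(1 / A) * t) = 2 * A := by
    rw [MeasureTheory.integral_const_mul, integral_exp_mul_Ioi hA']
    simp
  rw [← hval]
  refine MeasureTheory.integral_mono_of_nonneg
    (Filter.Eventually.of_forall fun t => MeasureTheory.measureReal_nonneg) hint
    (Filter.Eventually.of_forall fun t => ?_)
  simp only
  -- Solves `A * log (2 / δ) = t`. For small `t`, where `δ ≥ 1`, the trivial bound on a probability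
  -- is enough.
  set δ := 2 * Real.exp (-(1 / A) * t) with hδ
  have hδ0 : 0 < δ := by positivity
  rcases lt_or_ge δ 1 with h1 | h1
  · have hlog : A * Real.log (2 / δ) = t := by
      rw [hδ, ← div_div, div_self two_ne_zero, one_div, ← Real.exp_neg, Real.log_exp]
      field_simp
    have := htail δ hδ0 h1
    rw [hlog] at this
    exact ENNReal.toReal_le_of_le_ofReal hδ0.le this
  · exact MeasureTheory.measureReal_le_one.trans h1

theorem integrable_diffError {N : ℕ} (v r : Fin N → ℝ) (hv : ∀ i, 0 < v i)
    (hr0 : ∀ i, 0 ≤ r i) (hr1 : ∀ i, r i ≤ 1) {α : ℝ} (hα : 0 ≤ α)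
    (sel : History N → Finset (Fin N)) (T : ℕ) (S S' : Finset (Fin N)) :
    MeasureTheory.Integrable (diffError v r α S S') (law v hv α hα sel T) := by
  have : MeasureTheory.IsProbabilityMeasure (law v hv α hα sel T) :=
    PMF.toMeasure.isProbabilityMeasure _
  refine MeasureTheory.Integrable.of_bound (C := 2)
    (Measurable.aestronglyMeasurable fun _ _ => trivial)
    (Filter.Eventually.of_forall fun s => ?_)
  rw [Real.norm_of_nonneg (show 0 ≤ diffError v r α S S' s from abs_nonneg _)]
  exact diffError_le_two hr0 hr1 (fun i => (hv i).le) hα S S' s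

theorem integral_diffError_le {N : ℕ} (v r : Fin N → ℝ) (hv : ∀ i, 0 < v i)
    (hv1 : ∀ i, v i ≤ 1) (hr0 : ∀ i, 0 ≤ r i) (hr1 : ∀ i, r i ≤ 1) {α : ℝ} (hα : 0 ≤ α)
    (hα1 : α ≤ 1 / 2) (sel : History N → Finset (Fin N)) {T : ℕ} (hT : 1 ≤ T)
    (S S' : Finset (Fin N)) :
    ∫ s, diffError v r α S S' s ∂(law v hv α hα sel T) ≤
      144 * ((N : ℝ) + 1) ^ 3 * √((T : ℝ) ^ (α - 1)) := by
  have : MeasureTheory.IsProbabilityMeasure (law v hv α hα sel T) :=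
    PMF.toMeasure.isProbabilityMeasure _
  have hTr : (0 : ℝ) < T := by exact_mod_cast hT
  have hN1 : (1 : ℝ) ≤ (N : ℝ) + 1 := by linarith [(Nat.cast_nonneg N : (0 : ℝ) ≤ N)]
  set ρ := √((T : ℝ) ^ (α - 1)) with hρ
  have hρ0 : 0 < ρ := Real.sqrt_pos.2 (by positivity)
  have hxρ : ((N : ℝ) / T) ^ ((1 - α) / 2) ≤ ((N : ℝ) + 1) * ρ := by
    have h1 : ρ = ((T : ℝ) ^ ((1 - α) / 2))⁻¹ := by
      rw [hρ, Real.sqrt_eq_rpow, ← Real.rpow_mul hTr.le, ← Real.rpow_neg hTr.le]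
      congr 1
      ring
    rw [Real.div_rpow (by positivity) hTr.le, div_eq_mul_inv, ← h1]
    refine mul_le_mul_of_nonneg_right ?_ hρ0.le
    calc (N : ℝ) ^ ((1 - α) / 2) ≤ ((N : ℝ) + 1) ^ ((1 - α) / 2) :=
          Real.rpow_le_rpow (by positivity) (by linarith) (by linarith)
      _ ≤ ((N : ℝ) + 1) ^ (1 : ℝ) := Real.rpow_le_rpow_of_exponent_le hN1 (by linarith)
      _ = (N : ℝ) + 1 := Real.rpow_one _
  -- Using `N + 1` in place of `N` keeps `A` positive when `N = 0`.
  have key := integral_le_of_tail (A := 72 * (((N : ℝ) + 1) ^ 2 * (((N : ℝ) + 1) * ρ)))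
    (integrable_diffError v r hv hr0 hr1 hα sel T S S') (fun _ => abs_nonneg _)
    (by positivity) (fun δ hδ hδ1 => by
      refine le_trans (MeasureTheory.measure_mono ?_)
        (law_diffError_gt_le v r hv hv1 hr0 hr1 hα hα1 sel hT hδ hδ1)
      intro s hs hall
      refine absurd (hall S S') (not_le.2 (lt_of_le_of_lt ?_ hs))
      have hlog : 0 ≤ Real.log (2 / δ) :=
        Real.log_nonneg (by rw [le_div_iff₀ hδ]; linarith)
      have h2 : (N : ℝ) ^ 2 ≤ ((N : ℝ) + 1) ^ 2 :=
        pow_le_pow_left₀ (by positivity) (by linarith) 2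
      have h3 := mul_le_mul h2 hxρ (by positivity) (by positivity)
      have h4 := mul_le_mul_of_nonneg_left h3 (by positivity : 0 ≤ 72 * Real.log (2 / δ))
      linarith)
  linarith

end MNLBandit

/-- Estimation error of revenue differences for the MNL bandit policy with forced exploration:
the high-probability bound, and the rate of the expected error with a constant that depends on
the number of items only. -/
theorem corollary4p5 (N : ℕ) :
    ∃ C : ℝ, 0 < C ∧
      ∀ (v r : Fin N → ℝ) (hv : ∀ i, 0 < v i) (_hv1 : ∀ i, v i ≤ 1)
        (_hr0 : ∀ i, 0 ≤ r i) (_hr1 : ∀ i, r i ≤ 1)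
        (𝒮 : Finset (Finset (Fin N))) (_hne : 𝒮.Nonempty)
        (_hdown : ∀ S ∈ 𝒮, ∀ Q ⊆ S, Q ∈ 𝒮)
        (α : ℝ) (hα0 : 0 ≤ α) (_hα1 : α ≤ 1 / 2)
        (sel : MNLBandit.History N → Finset (Fin N))
        (_hsel : MNLBandit.IsOptimisticSelection r 𝒮 sel)
        (T : ℕ) (_hT : 1 ≤ T),
        (∀ δ : ℝ, 0 < δ → δ < 1 →
          ENNReal.ofReal (1 - δ) ≤ MNLBandit.law v hv α hα0 sel T
            {s | ∀ S S' : Finset (Fin N), MNLBandit.diffError v r α S S' s ≤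
              72 * Real.log (2 / δ) * (N : ℝ) ^ 2 * ((N : ℝ) / T) ^ ((1 - α) / 2)}) ∧
        (∀ S S' : Finset (Fin N),
          MeasureTheory.Integrable (MNLBandit.diffError v r α S S')
            (MNLBandit.law v hv α hα0 sel T) ∧
          ∫ s, MNLBandit.diffError v r α S S' s ∂(MNLBandit.law v hv α hα0 sel T) ≤
            C * √((T : ℝ) ^ (α - 1))) := by
  refine ⟨144 * ((N : ℝ) + 1) ^ 3, by positivity, ?_⟩
  intro v r hv hv1 hr0 hr1 𝒮 _ _ α hα hα1 sel _ T hT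
  refine ⟨fun δ hδ hδ1 => ?_, fun S S' =>
    ⟨MNLBandit.integrable_diffError v r hv hr0 hr1 hα sel T S S',
      MNLBandit.integral_diffError_le v r hv hv1 hr0 hr1 hα hα1 sel hT S S'⟩⟩
  have : MeasureTheory.IsProbabilityMeasure (MNLBandit.law v hv α hα sel T) :=
    PMF.toMeasure.isProbabilityMeasure _
  have h := MNLBandit.law_diffError_gt_le v r hv hv1 hr0 hr1 hα hα1 sel hT hδ hδ1
  rw [MeasureTheory.prob_compl_eq_one_sub (by trivial), tsub_le_iff_right] at h
  rw [ENNReal.ofReal_sub _ hδ.le, ENNReal.ofReal_one, tsub_le_iff_right, add_comm]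
  exact h
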